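/- Let $D$ be a squarefree positive integer, regard $\mathbb{Q}(\sqrt{-D})$ as a subfield of $\mathbb{C}$, and let $$Q_3=\{[z_1,z_2,z_3]\in P^2(\mathbb{C}) \mid z_1^2+z_2^2+z_3^2=0\}.$$ A point of $Q_3$ is called $\mathbb{Q}(\sqrt{-D})$-rational if it has homogeneous coordinates $(z_1,z_2,z_3)$ all of which lie in $\mathbb{Q}(\sqrt{-D})$. Then $Q_3$ has a $\mathbb{Q}(\sqrt{-D})$-rational point if and only if $D$ is not of the form $8k+7$ with $k$ a non-negative integer. Moreover, the equation $n_1^2+n_2^2+n_3^2=Dm^2$ has an integer solution $(n_1,n_2,n_3,m)\neq(0,0,0,0)$ if and only if $D$ is not of the form $8k+7$ with $k$ a non-negative integer. -/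

import Mathlib

/-- The complex projective quadric
`Q_N = {[z_1, …, z_N] ∈ P^{N-1}(ℂ) | z_1² + ⋯ + z_N² = 0}`.
The condition does not depend on the chosen homogeneous coordinates,
see `mk_mem_projQuadric_iff`. -/
def projQuadric (N : ℕ) : Set (Projectivization ℂ (Fin N → ℂ)) :=
  {p | ∑ i, p.rep i ^ 2 = 0}

/-- Membership in the quadric can be tested on any homogeneous coordinates. -/
theorem mk_mem_projQuadric_iff {N : ℕ} (z : Fin N → ℂ) (hz : z ≠ 0) :
    Projectivization.mk ℂ z hz ∈ projQuadric N ↔ ∑ i, z i ^ 2 = 0 := by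
  obtain ⟨a, ha⟩ := Projectivization.exists_smul_eq_mk_rep ℂ z hz
  have h : ∑ i, (Projectivization.mk ℂ z hz).rep i ^ 2 = (a : ℂ) ^ 2 * ∑ i, z i ^ 2 := by
    rw [← ha, Finset.mul_sum]
    refine Finset.sum_congr rfl fun i _ => ?_
    simp [Units.smul_def, mul_pow]
  simp [projQuadric, h]

/-- The subset `P^{N-1}(K) ⊆ P^{N-1}(ℂ)`, for a subfield `K` of `ℂ`: the points that
admit homogeneous coordinates all of which lie in `K`. -/
def projRationalPoints (K : IntermediateField ℚ ℂ) (N : ℕ) :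
    Set (Projectivization ℂ (Fin N → ℂ)) :=
  {p | ∃ (z : Fin N → ℂ) (hz : z ≠ 0), (∀ i, z i ∈ K) ∧ p = Projectivization.mk ℂ z hz}

/-- The imaginary quadratic field `ℚ(√-D)`, as a subfield of `ℂ`, where
`√-D = i √D`. -/
noncomputable def imagQuadraticField (D : ℕ) : IntermediateField ℚ ℂ :=
  IntermediateField.adjoin ℚ {Complex.I * (Real.sqrt (D : ℝ) : ℂ)}

/-!
Write `z = a + b √-D` with `a`, `b` rational vectors. Then `z · z = 0` says that `a ⊥ b` and
`|a|² = D |b|²`, so `(a × b) / |b|²` has squared length `D`. Conversely, if `v · v = D` and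
`b ⊥ v`, then `v × b + √-D b` is isotropic. Both claims thus reduce to deciding when `D` is a sum
of three rational squares.

Reduction modulo `8` and infinite descent exclude `D = 8 k + 7`. For the other `D` not divisible
by `4`, Dirichlet's theorem on primes in progressions and quadratic reciprocity provide `t ≡ -1`
modulo `D`, a prime `q ≡ 1` modulo `4` or twice such a prime, for which `D` is a square modulo `t`.
A box-principle argument then solves `D m² = y² + t z²`, and `t` is a sum of two squares.
-/

open scoped Matrix IntermediateField NumberTheorySymbols

section QuadraticExtension

variable {F K : Type*} [Field F] [Field K] [Algebra F K] {α : K} {d : F}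

lemma exists_eq_add_mul_of_mem_adjoin_simple (hα : α ^ 2 = algebraMap F K d) {x : K}
    (hx : x ∈ F⟮α⟯) : ∃ a b : F, x = algebraMap F K a + algebraMap F K b * α := by
  have hint : IsIntegral F α := IsIntegral.of_pow two_pos (hα ▸ isIntegral_algebraMap)
  rw [← IntermediateField.mem_toSubalgebra,
    IntermediateField.adjoin_simple_toSubalgebra_of_isAlgebraic hint.isAlgebraic] at hx
  induction hx using Algebra.adjoin_induction with
  | mem x hx => exact ⟨0, 1, by simpa using hx⟩
  | algebraMap r => exact ⟨r, 0, by simp⟩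
  | add x y _ _ hx hy =>
    obtain ⟨a, b, rfl⟩ := hx
    obtain ⟨c, e, rfl⟩ := hy
    exact ⟨a + c, b + e, by simp only [map_add]; ring⟩
  | mul x y _ _ hx hy =>
    obtain ⟨a, b, rfl⟩ := hx
    obtain ⟨c, e, rfl⟩ := hy
    refine ⟨a * c + d * (b * e), a * e + b * c, ?_⟩
    simp only [map_add, map_mul]
    linear_combination (algebraMap F K b * algebraMap F K e) * hα

variable [LinearOrder F] [IsStrictOrderedRing F]

lemma eq_zero_and_eq_zero_of_add_mul_eq_zero (hd : 0 < d) (hα : α ^ 2 = algebraMap F K (-d))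
    {a b : F} (h : algebraMap F K a + algebraMap F K b * α = 0) : a = 0 ∧ b = 0 := by
  have norm_eq_zero : a ^ 2 + d * b ^ 2 = 0 := by
    apply (algebraMap F K).injective
    simp only [map_add, map_mul, map_pow, map_neg, map_zero] at hα ⊢
    linear_combination (algebraMap F K a - algebraMap F K b * α) * h + algebraMap F K b ^ 2 * hα
  rw [add_eq_zero_iff_of_nonneg (by positivity) (by positivity)] at norm_eq_zero
  simpa [hd.ne'] using norm_eq_zero

lemma exists_dotProduct_self_eq_of_isotropic (hd : 0 < d) (hα : α ^ 2 = algebraMap F K (-d))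
    {z : Fin 3 → K} (hz : z ≠ 0) (hzα : ∀ i, z i ∈ F⟮α⟯) (h : z ⬝ᵥ z = 0) :
    ∃ v : Fin 3 → F, v ⬝ᵥ v = d := by
  choose a b hab using fun i ↦ exists_eq_add_mul_of_mem_adjoin_simple hα (hzα i)
  obtain ⟨norm_eq, orthogonal⟩ : a ⬝ᵥ a - d * b ⬝ᵥ b = 0 ∧ 2 * a ⬝ᵥ b = 0 := by
    apply eq_zero_and_eq_zero_of_add_mul_eq_zero hd hα
    simp only [Matrix.vec3_dotProduct, hab, map_add, map_sub, map_mul, map_ofNat, map_neg] at h hα ⊢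
    linear_combination h - (algebraMap F K (b 0) ^ 2 + algebraMap F K (b 1) ^ 2 +
      algebraMap F K (b 2) ^ 2) * hα
  have hab0 : a ⬝ᵥ b = 0 := by simpa using orthogonal
  have hb : b ⬝ᵥ b ≠ 0 := by
    intro hb
    have ha : a ⬝ᵥ a = 0 := by simpa [hb] using norm_eq
    rw [dotProduct_self_eq_zero] at ha hb
    exact hz (funext fun i ↦ by simp [hab i, ha, hb])
  -- Lagrange's identity: `|a × b|² = |a|² |b|² - (a · b)² = d |b|⁴`.
  refine ⟨(b ⬝ᵥ b)⁻¹ • (a ⨯₃ b), ?_⟩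
  rw [smul_dotProduct, dotProduct_smul, cross_dot_cross, dotProduct_comm b a, hab0,
    sub_eq_zero.1 norm_eq]
  simp only [smul_eq_mul]
  field_simp
  ring

lemma exists_isotropic_of_dotProduct_self_eq (hd : 0 < d) (hα : α ^ 2 = algebraMap F K (-d))
    {v : Fin 3 → F} (hv : v ⬝ᵥ v = d) :
    ∃ z : Fin 3 → K, z ≠ 0 ∧ (∀ i, z i ∈ F⟮α⟯) ∧ z ⬝ᵥ z = 0 := by
  obtain ⟨b, hvb, hb⟩ : ∃ b ∈ LinearMap.ker (dotProductBilin F F v), b ≠ 0 :=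
    Submodule.exists_mem_ne_zero_of_ne_bot (LinearMap.ker_ne_bot_of_finrank_lt (by simp))
  replace hvb : v ⬝ᵥ b = 0 := hvb
  let φ := algebraMap F K
  have hα0 : α ≠ 0 := by
    rintro rfl
    exact hd.ne' (by simpa using hα.symm)
  have hbz : φ ∘ b ⬝ᵥ (φ ∘ (v ⨯₃ b) + α • φ ∘ b) = α * φ (b ⬝ᵥ b) := by
    rw [dotProduct_add, dotProduct_smul, ← RingHom.map_dotProduct, ← RingHom.map_dotProduct,
      dot_cross_self, map_zero, zero_add, smul_eq_mul]
  refine ⟨φ ∘ (v ⨯₃ b) + α • φ ∘ b, fun hz ↦ ?_, fun i ↦ ?_, ?_⟩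
  · rw [hz, dotProduct_zero, eq_comm] at hbz
    simp [hα0, hb, φ] at hbz
  · exact add_mem (algebraMap_mem _ _) (mul_mem (IntermediateField.mem_adjoin_simple_self F α)
      (algebraMap_mem _ _))
  · rw [add_dotProduct, smul_dotProduct, hbz, dotProduct_add, dotProduct_smul,
      ← RingHom.map_dotProduct, ← RingHom.map_dotProduct, cross_dot_cross,
      dotProduct_comm (v ⨯₃ b), dot_cross_self, dotProduct_comm b v, hvb, hv]
    simp only [map_neg] at hα
    simp only [smul_eq_mul, map_mul, map_sub, map_zero]
    linear_combination φ (b ⬝ᵥ b) * hα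

theorem exists_isotropic_adjoin_simple_iff (hd : 0 < d) (hα : α ^ 2 = algebraMap F K (-d)) :
    (∃ z : Fin 3 → K, z ≠ 0 ∧ (∀ i, z i ∈ F⟮α⟯) ∧ z ⬝ᵥ z = 0) ↔
      ∃ v : Fin 3 → F, v ⬝ᵥ v = d :=
  ⟨fun ⟨_, hz, hzα, h⟩ ↦ exists_dotProduct_self_eq_of_isotropic hd hα hz hzα h,
    fun ⟨_, hv⟩ ↦ exists_isotropic_of_dotProduct_self_eq hd hα hv⟩

end QuadraticExtension

lemma exists_rat_dotProduct_self_eq_iff {ι : Type*} [Fintype ι] {D : ℤ} :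
    (∃ v : ι → ℚ, v ⬝ᵥ v = D) ↔
      ∃ (n : ι → ℤ) (m : ℤ), m ≠ 0 ∧ n ⬝ᵥ n = D * m ^ 2 := by
  constructor
  · rintro ⟨v, hv⟩
    obtain ⟨m, hm⟩ := IsLocalization.exist_integer_multiples_of_finite (nonZeroDivisors ℤ) v
    choose n hn using hm
    refine ⟨n, m, nonZeroDivisors.coe_ne_zero m, ?_⟩
    have hn : Int.castRingHom ℚ ∘ n = (m : ℚ) • v := funext fun i ↦ by simpa using hn i
    have : Int.castRingHom ℚ (n ⬝ᵥ n) = D * m ^ 2 := by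
      rw [RingHom.map_dotProduct, hn, smul_dotProduct, dotProduct_smul, hv, smul_eq_mul,
        smul_eq_mul]
      ring
    rw [eq_intCast] at this
    exact_mod_cast this
  · rintro ⟨n, m, hm, h⟩
    have hmQ : (m : ℚ) ≠ 0 := mod_cast hm
    refine ⟨(m : ℚ)⁻¹ • Int.castRingHom ℚ ∘ n, ?_⟩
    rw [smul_dotProduct, dotProduct_smul, ← RingHom.map_dotProduct, h]
    simp only [eq_intCast, Int.cast_mul, Int.cast_pow, smul_eq_mul]
    field_simp

lemma exists_int_sq_add_sq_add_sq_eq_mul_sq_iff {D : ℤ} :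
    (∃ n₁ n₂ n₃ m : ℤ, (n₁, n₂, n₃, m) ≠ (0, 0, 0, 0) ∧
        n₁ ^ 2 + n₂ ^ 2 + n₃ ^ 2 = D * m ^ 2) ↔ ∃ v : Fin 3 → ℚ, v ⬝ᵥ v = D := by
  rw [exists_rat_dotProduct_self_eq_iff]
  constructor
  · rintro ⟨n₁, n₂, n₃, m, hne, h⟩
    have hn : ![n₁, n₂, n₃] ⬝ᵥ ![n₁, n₂, n₃] = D * m ^ 2 := by
      simpa [Matrix.vec3_dotProduct, sq, ← add_assoc] using h
    refine ⟨_, m, ?_, hn⟩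
    rintro rfl
    rw [zero_pow two_ne_zero, mul_zero, dotProduct_self_eq_zero] at hn
    simp_all
  · rintro ⟨n, m, hm, h⟩
    exact ⟨n 0, n 1, n 2, m, by simp [hm], by simpa [Matrix.vec3_dotProduct, sq] using h⟩

lemma two_dvd_of_sq_add_sq_add_sq_eq_mul_sq {D a b c m : ℤ} (hD : D % 8 = 7)
    (h : a ^ 2 + b ^ 2 + c ^ 2 = D * m ^ 2) : 2 ∣ a ∧ 2 ∣ b ∧ 2 ∣ c ∧ 2 ∣ m := by
  have mod_eight : ∀ x y z w : ZMod 8, x ^ 2 + y ^ 2 + z ^ 2 = 7 * w ^ 2 →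
      4 * x = 0 ∧ 4 * y = 0 ∧ 4 * z = 0 ∧ 4 * w = 0 := by decide
  have even_of_mod_eight : ∀ x : ℤ, 4 * (x : ZMod 8) = 0 → 2 ∣ x := by
    intro x hx
    have : (8 : ℤ) ∣ 4 * x := (ZMod.intCast_zmod_eq_zero_iff_dvd (4 * x) 8).1 (mod_cast hx)
    omega
  have hD8 : (D : ZMod 8) = 7 := by
    rw [← ZMod.intCast_mod D 8, Nat.cast_ofNat, hD]
    rfl
  have h8 : (a : ZMod 8) ^ 2 + b ^ 2 + c ^ 2 = 7 * m ^ 2 := by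
    rw [← hD8]
    exact_mod_cast congrArg (Int.cast : ℤ → ZMod 8) h
  exact (mod_eight _ _ _ _ h8).imp (even_of_mod_eight _) (.imp (even_of_mod_eight _)
    (.imp (even_of_mod_eight _) (even_of_mod_eight _)))

lemma eq_zero_of_sq_add_sq_add_sq_eq_mul_sq {D a b c m : ℤ} (hD : D % 8 = 7)
    (h : a ^ 2 + b ^ 2 + c ^ 2 = D * m ^ 2) : m = 0 := by
  induction hk : m.natAbs using Nat.strong_induction_on generalizing a b c m with
  | _ k ih =>
    obtain ⟨⟨a, rfl⟩, ⟨b, rfl⟩, ⟨c, rfl⟩, ⟨m, rfl⟩⟩ :=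
      two_dvd_of_sq_add_sq_add_sq_eq_mul_sq hD h
    by_contra hm
    exact hm (by simp [ih m.natAbs (by omega) (by linarith : a ^ 2 + b ^ 2 + c ^ 2 = _) rfl])

lemma exists_ne_zero_sq_le_map_eq_zero {ι G : Type*} [Fintype ι] [AddGroup G] [Fintype G]
    (f : (ι → ℤ) →+ G) (n : ι → ℕ) (h : Fintype.card G ^ 2 < ∏ i, (n i + 1)) :
    ∃ v : ι → ℤ, v ≠ 0 ∧ (∀ i, v i ^ 2 ≤ n i) ∧ f v = 0 := by
  classical
  let box : Finset (ι → ℤ) := Finset.Icc 0 fun i ↦ ((n i).sqrt : ℤ)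
  have hcard : Fintype.card G < box.card := by
    have card_box : box.card = ∏ i, ((n i).sqrt + 1) := by simp [box, Pi.card_Icc]
    refine lt_of_pow_lt_pow_left₀ 2 (Nat.zero_le _) (h.trans_le ?_)
    rw [card_box, ← Finset.prod_pow]
    exact Finset.prod_le_prod' fun i _ ↦ Nat.succ_le_succ_sqrt' (n i)
  obtain ⟨v, hv, w, hw, hvw, hfvw⟩ := Finset.exists_ne_map_eq_of_card_lt_of_maps_to
    (t := Finset.univ) hcard (f := f) fun _ _ ↦ Finset.mem_univ _
  refine ⟨v - w, sub_ne_zero.2 hvw, fun i ↦ ?_, by rw [map_sub, hfvw, sub_self]⟩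
  simp only [box, Finset.mem_Icc, Pi.le_def] at hv hw
  calc (v i - w i) ^ 2
      ≤ ((n i).sqrt : ℤ) ^ 2 := sq_le_sq.2 <|
        (abs_sub_le_of_nonneg_of_le (hv.1 i) (hv.2 i) (hw.1 i) (hw.2 i)).trans (le_abs_self _)
    _ ≤ n i := mod_cast Nat.sqrt_le' (n i)

lemma exists_small_mul_dvd_sub {D t : ℕ} (hD : 0 < D) (ht : 0 < t) (hDt : D.Coprime t)
    (htD : IsSquare (-t : ZMod D)) (hDs : IsSquare (D : ZMod t)) :
    ∃ x y z : ℤ, ¬ (x = 0 ∧ y = 0 ∧ z = 0) ∧ x ^ 2 ≤ t ∧ y ^ 2 ≤ D * t ∧ z ^ 2 ≤ D ∧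
      (D * t : ℤ) ∣ D * x ^ 2 - (y ^ 2 + t * z ^ 2) := by
  have : NeZero D := ⟨hD.ne'⟩
  have : NeZero t := ⟨ht.ne'⟩
  obtain ⟨r, hr⟩ := htD
  obtain ⟨s, hs⟩ := hDs
  let f : (Fin 3 → ℤ) →+ ZMod D × ZMod t :=
    { toFun v := (v 1 - r * v 2, v 1 - s * v 0)
      map_zero' := by simp
      map_add' v w := by ext <;> push_cast [Pi.add_apply, Prod.mk_add_mk] <;> ring }
  obtain ⟨v, hv, hsmall, hfv⟩ := exists_ne_zero_sq_le_map_eq_zero f ![t, D * t, D] (by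
    simp only [Fintype.card_prod, ZMod.card, Fin.prod_univ_three, Matrix.cons_val]
    calc (D * t) ^ 2 < (D * t + t + D + 1) * (D * t + 1) := by nlinarith [mul_pos hD ht]
      _ = (t + 1) * (D * t + 1) * (D + 1) := by ring)
  obtain ⟨hD_y, ht_y⟩ : (v 1 - r * v 2 : ZMod D) = 0 ∧ (v 1 - s * v 0 : ZMod t) = 0 := by
    simpa [f] using hfv
  refine ⟨v 0, v 1, v 2, fun h ↦ hv ?_, hsmall 0, mod_cast hsmall 1, hsmall 2,
    (Nat.isCoprime_iff_coprime.2 hDt).mul_dvd ?_ ?_⟩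
  · ext i
    fin_cases i
    exacts [h.1, h.2.1, h.2.2]
  · rw [← ZMod.intCast_zmod_eq_zero_iff_dvd]
    push_cast
    rw [ZMod.natCast_self]
    linear_combination -(v 1 + r * v 2 : ZMod D) * hD_y + (v 2 : ZMod D) ^ 2 * hr
  · rw [← ZMod.intCast_zmod_eq_zero_iff_dvd]
    push_cast
    rw [ZMod.natCast_self]
    linear_combination -(v 1 + s * v 0 : ZMod t) * ht_y + (v 0 : ZMod t) ^ 2 * hs

lemma eq_zero_or_eq_neg_mul_of_mul_dvd {D t : ℕ} {x y z : ℤ} (hD : 0 < D) (ht : ¬ IsSquare t)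
    (hx : x ^ 2 ≤ t) (hy : y ^ 2 ≤ D * t) (hz : z ^ 2 ≤ D)
    (h : (D * t : ℤ) ∣ D * x ^ 2 - (y ^ 2 + t * z ^ 2)) :
    D * x ^ 2 - (y ^ 2 + t * z ^ 2) = 0 ∨ D * x ^ 2 - (y ^ 2 + t * z ^ 2) = -(D * t) := by
  have hD' : (0 : ℤ) < D := mod_cast hD
  have ht' : (0 : ℤ) < t := mod_cast Nat.pos_of_ne_zero fun h0 ↦ ht (by simp [h0])
  have sq_ne (n : ℤ) : n ^ 2 ≠ t := fun hn ↦ ht ⟨n.natAbs, by zify; rw [abs_mul_abs_self, ← sq, hn]⟩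
  have upper : D * x ^ 2 - (y ^ 2 + t * z ^ 2) < D * t := by
    have : D * x ^ 2 < D * t := by gcongr; exact hx.lt_of_ne (sq_ne x)
    nlinarith [sq_nonneg y, sq_nonneg z]
  -- Equality would force `z² = D` and `y² = D t`, hence `t = (y / z)²`.
  have lower : -(2 * (D * t)) < D * x ^ 2 - (y ^ 2 + t * z ^ 2) := by
    have htz : t * z ^ 2 ≤ t * D := by gcongr
    have hDx : 0 ≤ D * x ^ 2 := by positivity
    by_contra! hle
    have hz_eq : z ^ 2 = D := mul_left_cancel₀ ht'.ne' (by linarith)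
    have hy_eq : y ^ 2 = z ^ 2 * t := by rw [hz_eq]; linarith
    obtain ⟨w, rfl⟩ : z ∣ y := (Int.pow_dvd_pow_iff two_ne_zero).1 ⟨t, hy_eq⟩
    exact sq_ne w (mul_left_cancel₀ (hz_eq ▸ hD'.ne') (by rw [← hy_eq, mul_pow]))
  obtain ⟨k, hk⟩ := h
  have hDt : (0 : ℤ) < D * t := by positivity
  have hk_lt : k < 1 := lt_of_mul_lt_mul_left (by linarith) hDt.le
  have hk_gt : -2 < k := lt_of_mul_lt_mul_left (by linarith) hDt.le
  obtain rfl | rfl : k = 0 ∨ k = -1 := by omega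
  · exact .inl (by rw [hk, mul_zero])
  · exact .inr (by rw [hk, mul_neg_one])

lemma exists_mul_sq_eq_sq_add_mul_sq {D t : ℕ} (hD : 0 < D) (ht : ¬ IsSquare t)
    (hDt : D.Coprime t) (htD : IsSquare (-t : ZMod D)) (hDs : IsSquare (D : ZMod t)) :
    ∃ m y z : ℤ, m ≠ 0 ∧ D * m ^ 2 = y ^ 2 + t * z ^ 2 := by
  have ht0 : 0 < t := Nat.pos_of_ne_zero fun h0 ↦ ht (by simp [h0])
  obtain ⟨x, y, z, hne, hx, hy, hz, hdvd⟩ := exists_small_mul_dvd_sub hD ht0 hDt htD hDs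
  obtain h | h := eq_zero_or_eq_neg_mul_of_mul_dvd hD ht hx hy hz hdvd
  · refine ⟨x, y, z, ?_, by linear_combination h⟩
    rintro rfl
    have : y ^ 2 + t * z ^ 2 = 0 := by linear_combination -h
    rw [add_eq_zero_iff_of_nonneg (by positivity) (by positivity)] at this
    simp_all [ht0.ne']
  · -- Multiply `D (x² + t) = y² + t z²` by the norm `x² + t`, using Brahmagupta's identity.
    refine ⟨x ^ 2 + t, x * y - t * z, y + x * z, by positivity, ?_⟩
    linear_combination (x ^ 2 + t) * h

lemma isSquare_intCast_zmod_mul {m n : ℕ} {a : ℤ} (hc : m.Coprime n)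
    (hm : IsSquare (a : ZMod m)) (hn : IsSquare (a : ZMod n)) :
    IsSquare (a : ZMod (m * n)) := by
  have : IsSquare (a : ZMod m × ZMod n) := by
    obtain ⟨x, hx⟩ := hm
    obtain ⟨y, hy⟩ := hn
    exact ⟨(x, y), Prod.ext (by simpa using hx) (by simpa using hy)⟩
  simpa only [map_intCast] using this.map (ZMod.chineseRemainder hc).symm

lemma exists_rat_dotProduct_self_eq_of_dvd_add_one {D t : ℕ} (hD : 0 < D) (ht : ¬ IsSquare t)
    (ht2 : ∃ a b : ℕ, t = a ^ 2 + b ^ 2) (htD : D ∣ t + 1) (hDs : IsSquare (D : ZMod t)) :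
    ∃ v : Fin 3 → ℚ, v ⬝ᵥ v = D := by
  have hDt : D.Coprime t :=
    Nat.Coprime.coprime_dvd_left htD (by simp)
  have neg_t : (-t : ZMod D) = 1 := by
    have : ((t + 1 : ℕ) : ZMod D) = 0 := (ZMod.natCast_eq_zero_iff _ _).2 htD
    push_cast at this
    linear_combination -this
  obtain ⟨m, y, z, hm, h⟩ := exists_mul_sq_eq_sq_add_mul_sq hD ht hDt (neg_t ▸ IsSquare.one) hDs
  obtain ⟨a, b, rfl⟩ := ht2
  refine mod_cast exists_rat_dotProduct_self_eq_iff (D := D) |>.2 ⟨![y, a * z, b * z], m, hm, ?_⟩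
  simp only [Matrix.vec3_dotProduct, Matrix.cons_val]
  push_cast at h
  linear_combination -h

lemma exists_rat_dotProduct_self_eq_of_prime {D q : ℕ} (hD : 0 < D) (hq : q.Prime)
    (hq4 : q % 4 = 1) (hqD : D ∣ q + 1) (hJ : J(D | q) = 1) :
    ∃ v : Fin 3 → ℚ, v ⬝ᵥ v = D := by
  have : Fact q.Prime := ⟨hq⟩
  obtain ⟨a, b, hab⟩ := Nat.Prime.sq_add_sq (p := q) (by omega)
  exact exists_rat_dotProduct_self_eq_of_dvd_add_one hD hq.prime.irreducible.not_isSquare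
    ⟨a, b, hab.symm⟩ hqD (mod_cast ZMod.isSquare_of_jacobiSym_eq_one hJ)

lemma exists_rat_dotProduct_self_eq_of_two_mul_prime {D q : ℕ} (hD : 0 < D) (hq : q.Prime)
    (hq4 : q % 4 = 1) (hqD : D ∣ 2 * q + 1) (hJ : J(D | q) = 1) :
    ∃ v : Fin 3 → ℚ, v ⬝ᵥ v = D := by
  have : Fact q.Prime := ⟨hq⟩
  obtain ⟨a, b, hab⟩ := Nat.Prime.sq_add_sq (p := q) (by omega)
  have not_isSquare : ¬ IsSquare (2 * q) := by
    rintro ⟨r, hr⟩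
    obtain ⟨u, rfl⟩ : 2 ∣ r := or_self_iff.1 (Nat.prime_two.dvd_mul.1 ⟨q, hr.symm⟩)
    have : q = 2 * (u * u) := by linarith
    omega
  have isSquare_two : ∀ a : ZMod 2, IsSquare a := by decide
  have coprime : Nat.Coprime 2 q := (Nat.odd_iff.2 (by omega)).coprime_two_left
  exact exists_rat_dotProduct_self_eq_of_dvd_add_one hD not_isSquare
    (Nat.sq_add_sq_mul (x := 1) (y := 1) rfl hab.symm) hqD (mod_cast
      isSquare_intCast_zmod_mul coprime (isSquare_two _) (ZMod.isSquare_of_jacobiSym_eq_one hJ))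

lemma jacobiSym_mul_jacobiSym_eq_χ₄ {e N q : ℕ} (hq4 : q % 4 = 1) (hN : Odd N)
    (h : N ∣ e * q + 1) : J(e | N) * J(N | q) = ZMod.χ₄ N := by
  have hmod : (e * q : ℤ) % N = -1 % N :=
    (Int.modEq_iff_dvd.2 (by rw [sub_neg_eq_add]; exact_mod_cast h)).symm
  rw [← jacobiSym.quadratic_reciprocity_one_mod_four hq4 hN, ← jacobiSym.mul_left,
    jacobiSym.mod_left' hmod, jacobiSym.at_neg_one hN]

lemma exists_prime_modEq_and_dvd {D c e : ℕ} (hD : 0 < D) (hc : c % 4 = 1)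
    (hcD : D ∣ e * c + 1) :
    ∃ q : ℕ, q.Prime ∧ q ≡ c [MOD 4 * D] ∧ q % 4 = 1 ∧ D ∣ e * q + 1 := by
  have coprime_D : c.Coprime D := Nat.Coprime.coprime_dvd_right hcD (by simp)
  have coprime_four : c.Coprime 4 := (Nat.odd_iff.2 (by omega)).coprime_two_right.pow_right 2
  obtain ⟨q, -, hq, h⟩ := Nat.forall_exists_prime_gt_and_modEq 0 (by omega)
    (coprime_four.mul_right coprime_D)
  exact ⟨q, hq, h, (h.of_mul_right D).trans (show c ≡ 1 [MOD 4] from hc),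
    ((((h.of_mul_left 4).mul_left e).add_right 1).dvd_iff dvd_rfl).2 hcD⟩

lemma exists_rat_dotProduct_self_eq_of_mod_four_eq_one {D : ℕ} (hD : D % 4 = 1) :
    ∃ v : Fin 3 → ℚ, v ⬝ᵥ v = D := by
  obtain ⟨q, hq, -, hq4, hqD⟩ := exists_prime_modEq_and_dvd (c := 2 * D - 1) (e := 1)
    (by omega : 0 < D) (by omega) ⟨2, by omega⟩
  have hJ := jacobiSym_mul_jacobiSym_eq_χ₄ hq4 (Nat.odd_iff.2 (by omega)) hqD
  rw [Nat.cast_one, jacobiSym.one_left, one_mul, ZMod.χ₄_nat_one_mod_four hD] at hJ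
  exact exists_rat_dotProduct_self_eq_of_prime (by omega) hq hq4 (by simpa using hqD) hJ

lemma exists_rat_dotProduct_self_eq_of_mod_four_eq_two {D : ℕ} (hD : D % 4 = 2) :
    ∃ v : Fin 3 → ℚ, v ⬝ᵥ v = D := by
  obtain ⟨N, rfl⟩ : 2 ∣ D := by omega
  obtain ⟨q, hq, hqc, hq4, hqD⟩ := exists_prime_modEq_and_dvd (c := 2 * N - 1) (e := 1)
    (by omega : 0 < 2 * N) (by omega) ⟨1, by omega⟩
  have hq8 : q % 8 = (2 * N - 1) % 8 :=
    (show 4 * (2 * N) = 8 * N by ring) ▸ hqc |>.of_mul_right N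
  have hJN : J(N | q) = ZMod.χ₄ N := by
    simpa using jacobiSym_mul_jacobiSym_eq_χ₄ hq4 (Nat.odd_iff.2 (by omega))
      ((dvd_mul_left N 2).trans hqD)
  -- `2 N - 1` is `1` or `5` modulo `8` according as `N` is `1` or `3` modulo `4`.
  have hJ2 : J(2 | q) = ZMod.χ₄ N := by
    rw [jacobiSym.at_two (Nat.odd_iff.2 (by omega)), ZMod.χ₈_nat_eq_if_mod_eight,
      ZMod.χ₄_nat_eq_if_mod_four]
    grind
  have hJ : J((2 * N : ℕ) | q) = 1 := by
    rw [Nat.cast_mul, jacobiSym.mul_left, hJN, ← hJ2, Nat.cast_ofNat, ← sq]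
    exact jacobiSym.sq_one (mod_cast (Nat.odd_iff.2 (by omega)).coprime_two_left)
  exact exists_rat_dotProduct_self_eq_of_prime (by omega) hq hq4 (by simpa using hqD) hJ

lemma exists_rat_dotProduct_self_eq_of_mod_eight_eq_three {D : ℕ} (hD : D % 8 = 3) :
    ∃ v : Fin 3 → ℚ, v ⬝ᵥ v = D := by
  obtain ⟨q, hq, -, hq4, hqD⟩ := exists_prime_modEq_and_dvd (c := D / 2) (e := 2)
    (by omega : 0 < D) (by omega) ⟨1, by omega⟩
  have hD_odd : Odd D := Nat.odd_iff.2 (by omega)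
  have hJ := jacobiSym_mul_jacobiSym_eq_χ₄ hq4 hD_odd hqD
  have hJ2 : J(2 | D) = -1 := by
    rw [jacobiSym.at_two hD_odd, ZMod.χ₈_nat_mod_eight, hD]
    rfl
  rw [Nat.cast_ofNat, hJ2, ZMod.χ₄_nat_three_mod_four (by omega), neg_one_mul, neg_inj] at hJ
  exact exists_rat_dotProduct_self_eq_of_two_mul_prime (by omega) hq hq4 hqD hJ

theorem exists_rat_dotProduct_self_eq_iff_not_mod_eight {D : ℕ} (hD : ¬ 4 ∣ D) :
    (∃ v : Fin 3 → ℚ, v ⬝ᵥ v = D) ↔ ¬ ∃ k : ℕ, D = 8 * k + 7 := by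
  constructor
  · rintro hv ⟨k, hk⟩
    obtain ⟨n, m, hm, h⟩ := exists_rat_dotProduct_self_eq_iff (D := D) |>.1 (mod_cast hv)
    refine hm (eq_zero_of_sq_add_sq_add_sq_eq_mul_sq (D := D) (a := n 0) (b := n 1) (c := n 2)
      (by omega) ?_)
    simpa only [Matrix.vec3_dotProduct, sq] using h
  · intro h7
    have hD7 : D % 8 ≠ 7 := fun h ↦ h7 ⟨D / 8, by omega⟩
    obtain h | h | h : D % 4 = 1 ∨ D % 4 = 2 ∨ D % 8 = 3 := by omega
    · exact exists_rat_dotProduct_self_eq_of_mod_four_eq_one h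
    · exact exists_rat_dotProduct_self_eq_of_mod_four_eq_two h
    · exact exists_rat_dotProduct_self_eq_of_mod_eight_eq_three h

lemma exists_mem_projQuadric_mem_projRationalPoints_iff {K : IntermediateField ℚ ℂ} {N : ℕ} :
    (∃ p, p ∈ projQuadric N ∧ p ∈ projRationalPoints K N) ↔
      ∃ z : Fin N → ℂ, z ≠ 0 ∧ (∀ i, z i ∈ K) ∧ z ⬝ᵥ z = 0 := by
  have sum_sq (z : Fin N → ℂ) : ∑ i, z i ^ 2 = z ⬝ᵥ z := by simp only [dotProduct, sq]
  constructor
  · rintro ⟨_, hp, z, hz, hzK, rfl⟩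
    exact ⟨z, hz, hzK, sum_sq z ▸ (mk_mem_projQuadric_iff z hz).1 hp⟩
  · rintro ⟨z, hz, hzK, h⟩
    exact ⟨_, (mk_mem_projQuadric_iff z hz).2 (sum_sq z ▸ h), z, hz, hzK, rfl⟩

lemma I_mul_sqrt_natCast_sq (D : ℕ) :
    (Complex.I * (Real.sqrt (D : ℝ) : ℂ)) ^ 2 = algebraMap ℚ ℂ (-D) := by
  rw [mul_pow, Complex.I_sq, ← Complex.ofReal_pow, Real.sq_sqrt (Nat.cast_nonneg D)]
  simp

theorem proposition4p2_general (D : ℕ) (hD : ¬ 4 ∣ D) :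
    ((∃ p : Projectivization ℂ (Fin 3 → ℂ),
        p ∈ projQuadric 3 ∧ p ∈ projRationalPoints (imagQuadraticField D) 3) ↔
      ¬ ∃ k : ℕ, D = 8 * k + 7) ∧
    ((∃ n₁ n₂ n₃ m : ℤ, (n₁, n₂, n₃, m) ≠ (0, 0, 0, 0) ∧
        n₁ ^ 2 + n₂ ^ 2 + n₃ ^ 2 = (D : ℤ) * m ^ 2) ↔
      ¬ ∃ k : ℕ, D = 8 * k + 7) := by
  have hD0 : (0 : ℚ) < D := by
    rw [Nat.cast_pos]
    omega
  rw [← exists_rat_dotProduct_self_eq_iff_not_mod_eight hD]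
  constructor
  · exact exists_mem_projQuadric_mem_projRationalPoints_iff.trans
      (exists_isotropic_adjoin_simple_iff hD0 (I_mul_sqrt_natCast_sq D))
  · exact exists_int_sq_add_sq_add_sq_eq_mul_sq_iff

theorem proposition4p2 (D : ℕ) (hD : Squarefree D) :
    ((∃ p : Projectivization ℂ (Fin 3 → ℂ),
        p ∈ projQuadric 3 ∧ p ∈ projRationalPoints (imagQuadraticField D) 3) ↔
      ¬ ∃ k : ℕ, D = 8 * k + 7) ∧
    ((∃ n₁ n₂ n₃ m : ℤ, (n₁, n₂, n₃, m) ≠ (0, 0, 0, 0) ∧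
        n₁ ^ 2 + n₂ ^ 2 + n₃ ^ 2 = (D : ℤ) * m ^ 2) ↔
      ¬ ∃ k : ℕ, D = 8 * k + 7) :=
  proposition4p2_general D fun h ↦ by simpa using hD 2 h
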